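/- For a finite non-abelian group $G$, the centralizer graph $\Gamma_{cent}(G)$ is the simple graph whose vertices are the distinct proper centralizers $C_G(x)\neq G$ ($x\in G$), two distinct vertices being adjacent if and only if they have the same cardinality; the co-centralizer graph $\overline{\Gamma_{cent}(G)}$ is its complement. For a connected graph $H$ with distance matrix $D(H)=(d_{uv})$, let $Tr(H)$ be the diagonal matrix whose $v$-th diagonal entry is $\sum_u d_{vu}$; the distance signless Laplacian spectrum of $H$ is the multiset of eigenvalues (roots of the characteristic polynomial, with multiplicity) of $D^Q(H)=Tr(H)+D(H)$. **Theorem.** Let $k\ge 2$. The graph $\overline{\Gamma_{cent}(PSL(2,2^k))}$ is connected, and its distance signless Laplacian spectrum is the multiset consisting of: (a) $2^{k+1}+2^{2k}-2$ with multiplicity $2^k$; (b) $3\cdot 2^{2k-1}+3\cdot 2^{k-1}-3$ with multiplicity $2^{k-1}(2^k+1)-1$; (c) $3\cdot 2^{2k-1}+2^{k-1}-3$ with multiplicity $2^{k-1}(2^k-1)-1$; and (d) the three eigenvalues, all real and counted with multiplicity, of the matrix $$\mathfrak{D}_P=\begin{bmatrix} 2^{k+1}+2^{2k}-2+2(2^k+1)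 & 2^{k-1}(2^k+1) & 2^{k-1}(2^k-1)\\ 2^k+1 & 3\cdot 2^{2k-1}+3\cdot 2^{k-1}-3+2^k(2^k+1) & 2^{k-1}(2^k-1)\\ 2^k+1 & 2^{k-1}(2^k+1) & 3\cdot 2^{2k-1}+2^{k-1}-3+2^k(2^k-1) \end{bmatrix}.$$ -/

import Mathlib

noncomputable section

namespace CoCentralizer

/-- The proper centralizers of `G`: the subgroups `C_G(x)`, `x ∈ G`, that differ from `G`
(each subgroup counted once, however many elements `x` it arises from). -/
def ProperCentralizer (G : Type*) [Group G] : Type _ :=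
  {H : Subgroup G // (∃ x : G, H = Subgroup.centralizer {x}) ∧ H ≠ ⊤}

instance (G : Type*) [Group G] [Finite G] : Finite (ProperCentralizer G) :=
  inferInstanceAs (Finite {H : Subgroup G // (∃ x : G, H = Subgroup.centralizer {x}) ∧ H ≠ ⊤})

instance (G : Type*) [Group G] [Finite G] : Fintype (ProperCentralizer G) :=
  Fintype.ofFinite _

instance (G : Type*) [Group G] : DecidableEq (ProperCentralizer G) :=
  Classical.decEq _

/-- The centralizer graph: two distinct proper centralizers are adjacent iff they have the
same cardinality. -/
def centralizerGraph (G : Type*) [Group G] : SimpleGraph (ProperCentralizer G) where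
  Adj H K := H ≠ K ∧ Nat.card H.1 = Nat.card K.1
  symm := ⟨fun _ _ h => ⟨h.1.symm, h.2.symm⟩⟩
  loopless := ⟨fun _ h => h.1 rfl⟩

/-- The co-centralizer graph: the complement of the centralizer graph. -/
def coCentralizerGraph (G : Type*) [Group G] : SimpleGraph (ProperCentralizer G) :=
  (centralizerGraph G)ᶜ

section Distance

variable {V : Type*} [Fintype V] [DecidableEq V]

/-- The distance matrix of a graph. -/
def distanceMatrix (H : SimpleGraph V) : Matrix V V ℝ :=
  Matrix.of fun u v => (H.dist u v : ℝ)

/-- The transmission of a vertex: the sum of its distances to all vertices. -/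
def transmission (H : SimpleGraph V) (v : V) : ℝ :=
  ∑ u, (H.dist v u : ℝ)

/-- The distance signless Laplacian matrix `Tr(H) + D(H)`. -/
def distanceSignlessLaplacian (H : SimpleGraph V) : Matrix V V ℝ :=
  Matrix.diagonal (transmission H) + distanceMatrix H

/-- The real spectrum of a matrix: the multiset of real roots of its characteristic polynomial,
each repeated according to its multiplicity. -/
def realSpectrum (M : Matrix V V ℝ) : Multiset ℝ :=
  M.charpoly.roots

end Distance

/-- The group `PSL(2, 2^k)` over the field with `2^k` elements. -/
abbrev PSL2 (k : ℕ) : Type :=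
  Matrix.ProjectiveSpecialLinearGroup (Fin 2) (GaloisField 2 k)

instance (k : ℕ) : Finite (PSL2 k) :=
  haveI : Finite (Matrix.SpecialLinearGroup (Fin 2) (GaloisField 2 k)) :=
    inferInstanceAs (Finite {A : Matrix (Fin 2) (Fin 2) (GaloisField 2 k) // A.det = 1})
  Quotient.finite _

/-- The quotient matrix `𝔇_P` (used for `k ≥ 2`, so that the exponents do not truncate). -/
def quotientMatrix (k : ℕ) : Matrix (Fin 3) (Fin 3) ℝ :=
  !![2 ^ (k + 1) + 2 ^ (2 * k) - 2 + 2 * (2 ^ k + 1),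
      2 ^ (k - 1) * (2 ^ k + 1),
      2 ^ (k - 1) * (2 ^ k - 1);
    2 ^ k + 1,
      3 * 2 ^ (2 * k - 1) + 3 * 2 ^ (k - 1) - 3 + 2 ^ k * (2 ^ k + 1),
      2 ^ (k - 1) * (2 ^ k - 1);
    2 ^ k + 1,
      2 ^ (k - 1) * (2 ^ k + 1),
      3 * 2 ^ (2 * k - 1) + 2 ^ (k - 1) - 3 + 2 ^ k * (2 ^ k - 1)]

end CoCentralizer

end

namespace CoCentralizer

/-! Write q = 2^k. In characteristic two `SL₂` has trivial center, so PSL(2, q) is SL(2, q). A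
matrix commuting with a nonscalar 2 × 2 matrix x lies in the plane F[x], so commuting is an
equivalence relation on nonscalar matrices. Hence the proper centralizers are the groups F[x] ∩ SL₂
with x a nonidentity element of SL₂, and every nonidentity element lies in exactly one of them.

The order of such a centralizer is the number of pairs (a, b) with det(a + b x) = 1. Squaring is
bijective on F, so this number is q + 1 minus the number of roots in F of z² + tr(x) z + det(x). It
equals q when the trace is 0, and q - 1 or q + 1 otherwise. Counting nonscalar matrices, elements of
SL₂ and trace zero elements gives three linear equations for the numbers of centralizers of each
order (`card_properCentralizer_card_eq`): q + 1 of order q, q(q + 1)/2 of order q - 1, q(q - 1)/2 of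
order q + 1.

The co-centralizer graph is therefore complete multipartite with three parts of these sizes, and its
distances are 0, 1 or 2. Its distance signless Laplacian is a diagonal matrix plus a matrix constant
on blocks. The identity det(1 - NP) = det(1 - PN) reduces its characteristic polynomial to that of
the 3 × 3 quotient matrix (`roots_charpoly_block`); a part of size m adds m - 1 copies of its
diagonal value. -/

/-! ### Characteristic polynomials of block-constant matrices -/

open Polynomial in
/-- The characteristic polynomial of a matrix that is, up to a diagonal term, constant on the
blocks of a partition, in terms of that of its quotient matrix. -/
theorem charpoly_block_mul_prod {K V ι : Type*} [Field K] [Infinite K] [Fintype V] [DecidableEq V]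
    [Fintype ι] [DecidableEq ι] (f : V → ι) (d : ι → K) (w : Matrix ι ι K) :
    (Matrix.diagonal (fun v => d (f v)) + Matrix.of fun u v => w (f u) (f v)).charpoly *
        ∏ i, (X - C (d i)) =
      (∏ v, (X - C (d (f v)))) *
        (Matrix.diagonal d +
          w * Matrix.diagonal fun i => ((Finset.univ.filter fun v => f v = i).card : K)).charpoly := by
  set m : ι → K := fun i => ((Finset.univ.filter fun v => f v = i).card : K) with hm
  -- For t outside the range of d, the diagonal part of t - M is invertible, so t - M = (1 - NP) ·
  -- diag(t - d ∘ f), where N P factors through the blocks. Passing from NP to PN gives the quotient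
  -- matrix. Infinitely many such t suffice to identify the polynomials.
  have key : ∀ t : K, (∀ i, t - d i ≠ 0) →
      ((Matrix.diagonal (fun v => d (f v)) + Matrix.of fun u v => w (f u) (f v)).charpoly *
        ∏ i, (X - C (d i))).eval t =
      ((∏ v, (X - C (d (f v)))) * (Matrix.diagonal d + w * Matrix.diagonal m).charpoly).eval t := by
    intro t ht
    let N : Matrix V ι K := Matrix.of fun v i => if f v = i then 1 else 0
    let P : Matrix ι V K :=
      w * Matrix.of fun i v => if f v = i then (t - d (f v))⁻¹ else 0
    have hPN : P * N = w * Matrix.diagonal fun i => m i * (t - d i)⁻¹ := by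
      rw [Matrix.mul_assoc]
      congr 1
      ext i j
      rw [Matrix.mul_apply, Matrix.diagonal_apply]
      simp only [N, Matrix.of_apply, mul_ite, mul_one, mul_zero]
      split_ifs with hij
      · subst hij
        rw [hm, ← Finset.sum_filter, Finset.sum_congr rfl (g := fun _ => (t - d i)⁻¹)]
        · simp
        · intro v hv
          simp only [Finset.mem_filter] at hv
          simp [hv.2]
      · refine Finset.sum_eq_zero fun v _ => ?_
        split_ifs with h1 h2
        · exact absurd (h2.symm.trans h1) hij
        · rfl
        · rfl
    have h1 : Matrix.scalar V t -
        (Matrix.diagonal (fun v => d (f v)) + Matrix.of fun u v => w (f u) (f v)) =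
        (1 - N * P) * Matrix.diagonal fun v => t - d (f v) := by
      ext u v
      have : (N * P) u v = w (f u) (f v) * (t - d (f v))⁻¹ := by
        simp [N, P, Matrix.mul_apply]
      simp only [Matrix.sub_apply, Matrix.add_apply, Matrix.mul_diagonal, this, Matrix.scalar_apply,
        Matrix.diagonal_apply, Matrix.of_apply, Matrix.one_apply]
      have := ht (f v)
      by_cases huv : u = v
      · subst huv; simp; field_simp; ring
      · simp [huv, this]
    have h2 : Matrix.scalar ι t - (Matrix.diagonal d + w * Matrix.diagonal m) =
        (1 - P * N) * Matrix.diagonal fun i => t - d i := by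
      rw [hPN]
      ext i j
      simp only [Matrix.sub_apply, Matrix.add_apply, Matrix.mul_diagonal, Matrix.scalar_apply,
        Matrix.diagonal_apply, Matrix.one_apply]
      have := ht j
      by_cases hij : i = j
      · subst hij; simp; field_simp; ring
      · simp [hij]; field_simp
    rw [eval_mul, eval_mul, Matrix.eval_charpoly, Matrix.eval_charpoly, h1, h2, Matrix.det_mul,
      Matrix.det_mul, Matrix.det_one_sub_mul_comm, Matrix.det_diagonal, Matrix.det_diagonal,
      eval_prod, eval_prod]
    simp only [eval_sub, eval_X, eval_C]
    ring
  refine Polynomial.eq_of_infinite_eval_eq _ _ ?_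
  refine Set.Infinite.mono (s := (Set.range d)ᶜ) (fun t ht => key t fun i hi => ht ⟨i, ?_⟩)
    (Set.finite_range d).infinite_compl
  exact (sub_eq_zero.mp hi).symm

open Polynomial in
/-- The root multiset of the characteristic polynomial of a matrix as in
`charpoly_block_mul_prod`, when every block is nonempty. -/
theorem roots_charpoly_block {V ι : Type*} [Fintype V] [DecidableEq V]
    [Fintype ι] [DecidableEq ι] (f : V → ι) (hf : Function.Surjective f) (d : ι → ℝ)
    (w : Matrix ι ι ℝ) (hw : w.IsSymm) :
    (Matrix.diagonal d +
          w * Matrix.diagonal fun i => ((Finset.univ.filter fun v => f v = i).card : ℝ)).charpoly.Splits ∧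
    (Matrix.diagonal (fun v => d (f v)) + Matrix.of fun u v => w (f u) (f v)).charpoly.roots =
      (∑ i, Multiset.replicate ((Finset.univ.filter fun v => f v = i).card - 1) (d i)) +
      (Matrix.diagonal d +
        w * Matrix.diagonal fun i =>
          ((Finset.univ.filter fun v => f v = i).card : ℝ)).charpoly.roots := by
  classical
  have key := charpoly_block_mul_prod f d w
  set M := Matrix.diagonal (fun v => d (f v)) + Matrix.of fun u v => w (f u) (f v) with hM
  set B := Matrix.diagonal d +
    w * Matrix.diagonal fun i => ((Finset.univ.filter fun v => f v = i).card : ℝ)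
  -- One factor per block is split off to cancel the product in `key`; surjectivity of f keeps the
  -- subtraction in the exponent from truncating.
  have hfib : ∏ v, (X - C (d (f v))) =
      (∏ i, (X - C (d i)) ^ ((Finset.univ.filter fun v => f v = i).card - 1)) *
        ∏ i, (X - C (d i)) := by
    rw [← Finset.prod_mul_distrib, ← Finset.prod_fiberwise (g := f)]
    refine Finset.prod_congr rfl fun i _ => ?_
    rw [← pow_succ, Nat.sub_add_cancel, Finset.prod_congr rfl (g := fun _ => X - C (d i)),
      Finset.prod_const]
    · intro v hv
      rw [(Finset.mem_filter.mp hv).2]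
    · obtain ⟨v, hv⟩ := hf i
      exact Finset.card_pos.mpr ⟨v, by simp [hv]⟩
  have hne : ∏ i, (X - C (d i)) ≠ 0 := Finset.prod_ne_zero_iff.mpr fun i _ => X_sub_C_ne_zero _
  have hne' : ∏ i, (X - C (d i)) ^ ((Finset.univ.filter fun v => f v = i).card - 1) ≠ 0 :=
    Finset.prod_ne_zero_iff.mpr fun i _ => pow_ne_zero _ (X_sub_C_ne_zero _)
  have hchar : M.charpoly =
      (∏ i, (X - C (d i)) ^ ((Finset.univ.filter fun v => f v = i).card - 1)) * B.charpoly := by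
    refine mul_right_cancel₀ hne ?_
    rw [key, hfib]
    ring
  -- The quotient matrix need not be symmetric; its characteristic polynomial splits because it
  -- divides that of the real symmetric matrix M.
  have hMsymm : M.IsHermitian := by
    ext u v
    simp only [hM, Matrix.conjTranspose_apply, Matrix.add_apply, Matrix.diagonal_apply,
      Matrix.of_apply, star_trivial]
    rw [← hw.apply (f u) (f v)]
    by_cases h : u = v
    · simp [h]
    · simp [h, Ne.symm h]
  refine ⟨(hMsymm.splits_charpoly).of_dvd (M.charpoly_monic.ne_zero) ⟨_, hchar.trans (mul_comm _ _)⟩, ?_⟩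
  rw [hchar, roots_mul (mul_ne_zero hne' B.charpoly_monic.ne_zero), roots_prod _ _ hne']
  congr 1
  simp only [roots_pow, roots_X_sub_C, Multiset.bind, Multiset.nsmul_singleton, Multiset.join]
  rfl

/-- Adjacency in a co-centralizer graph is inequality of cardinalities. -/
theorem coCentralizerGraph_adj {G : Type*} [Group G] (H K : ProperCentralizer G) :
    (coCentralizerGraph G).Adj H K ↔ Nat.card H.1 ≠ Nat.card K.1 := by
  simp only [coCentralizerGraph, SimpleGraph.compl_adj, centralizerGraph]
  constructor
  · rintro ⟨h, h'⟩ hc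
    exact h' ⟨h, hc⟩
  · intro h
    exact ⟨fun e => h (by rw [e]), fun h' => h h'.2⟩

/-! ### Distances in complete multipartite graphs -/

section Multipartite

variable {V ι : Type*} {Γ : SimpleGraph V} {f : V → ι}

/-- A complete multipartite graph with at least two nonempty parts is connected. -/
theorem connected_of_adj_iff [Nontrivial ι] (hf : Function.Surjective f)
    (hΓ : ∀ u v, Γ.Adj u v ↔ f u ≠ f v) : Γ.Connected := by
  obtain ⟨i⟩ := (inferInstance : Nonempty ι)
  have : Nonempty V := ⟨(hf i).choose⟩
  refine ⟨fun u v => ?_⟩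
  by_cases h : f u = f v
  · obtain ⟨j, hj⟩ := exists_ne (f u)
    obtain ⟨x, rfl⟩ := hf j
    exact ((hΓ u x).mpr hj.symm).reachable.trans ((hΓ x v).mpr (h ▸ hj)).reachable
  · exact ((hΓ u v).mpr h).reachable

/-- Distances in a complete multipartite graph with at least two nonempty parts. -/
theorem dist_of_adj_iff [Nontrivial ι] [DecidableEq V] [DecidableEq ι]
    (hf : Function.Surjective f) (hΓ : ∀ u v, Γ.Adj u v ↔ f u ≠ f v) (u v : V) :
    Γ.dist u v = if u = v then 0 else if f u = f v then 2 else 1 := by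
  split_ifs with h hfuv
  · rw [h, SimpleGraph.dist_self]
  · obtain ⟨j, hj⟩ := exists_ne (f u)
    obtain ⟨x, rfl⟩ := hf j
    have h1 : Γ.dist u v ≠ 1 := fun e => (hΓ u v).mp (SimpleGraph.dist_eq_one_iff_adj.mp e) hfuv
    have h0 : 0 < Γ.dist u v := (connected_of_adj_iff hf hΓ).pos_dist_of_ne h
    have h2 : Γ.dist u v ≤ 2 := SimpleGraph.dist_le
      (.cons ((hΓ u x).mpr hj.symm) (.cons ((hΓ x v).mpr (hfuv ▸ hj)) .nil))
    omega
  · exact SimpleGraph.dist_eq_one_iff_adj.mpr ((hΓ u v).mpr hfuv)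

/-- The distance signless Laplacian of a complete multipartite graph in block form. -/
theorem distanceSignlessLaplacian_of_adj_iff [Fintype V] [Nontrivial ι] [DecidableEq V]
    [DecidableEq ι] (hf : Function.Surjective f) (hΓ : ∀ u v, Γ.Adj u v ↔ f u ≠ f v) :
    distanceSignlessLaplacian Γ =
      Matrix.diagonal (fun v => (Fintype.card V : ℝ) +
        (Finset.univ.filter fun u => f u = f v).card - 4) +
      Matrix.of fun u v => if f u = f v then 2 else 1 := by
  -- Counting 1 for every vertex and 1 more for those in the part of v charges 2 for v itself,
  -- whence the -2. The block matrix also has 2 on its diagonal where the distance is 0, which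
  -- accounts for the -4 in the statement.
  have htr : ∀ v, transmission Γ v = (Fintype.card V : ℝ) +
      (Finset.univ.filter fun u => f u = f v).card - 2 := by
    intro v
    have : ∀ u, (Γ.dist v u : ℝ) =
        1 + (if f u = f v then 1 else 0) - if v = u then 2 else 0 := by
      intro u
      rw [dist_of_adj_iff hf hΓ]
      by_cases h : v = u
      · simp [h]; norm_num
      · by_cases h' : f u = f v
        · simp [h, h']; norm_num
        · simp [h, h', Ne.symm h']
    simp only [transmission, this, Finset.sum_sub_distrib, Finset.sum_add_distrib]
    simp
  ext u v
  simp only [distanceSignlessLaplacian, distanceMatrix, Matrix.add_apply, Matrix.diagonal_apply,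
    Matrix.of_apply, htr, dist_of_adj_iff hf hΓ]
  by_cases h : u = v
  · simp [h]; ring
  · by_cases h' : f u = f v
    · simp [h, h']
    · simp [h, h']

end Multipartite

/-! ### Values of binary quadratic forms in characteristic two -/

section QuadraticForm

variable {F : Type*} [Field F] [Finite F] [CharP F 2]

theorem exists_sq_eq (c : F) : ∃ s : F, s ^ 2 = c :=
  (Finite.surjective_of_injective (CharTwo.sq_injective (R := F))) c

/-- In characteristic two, the number of representations of `1` by the binary quadratic form
`a² + t a b + d b²` and the number of roots of `z² + t z + d` add up to `q + 1`. -/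
theorem card_norm_one_add_card_roots (t d : F) :
    Nat.card {p : F × F // p.1 ^ 2 + p.1 * p.2 * t + p.2 ^ 2 * d = 1} +
      Nat.card {z : F // z ^ 2 + z * t + d = 0} = Nat.card F + 1 := by
  classical
  let Q : F × F → F := fun p => p.1 ^ 2 + p.1 * p.2 * t + p.2 ^ 2 * d
  -- Q(u p) = u² Q(p) and every element has a unique square root, so each vector with Q ≠ 0 is
  -- uniquely a unit times a vector with Q = 1.
  have e1 : Nat.card {p : F × F // Q p ≠ 0} =
      Nat.card (Fˣ × {p : F × F // Q p = 1}) := by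
    have hQ : ∀ x : Fˣ × {p : F × F // Q p = 1}, Q (x.1 * x.2.1.1, x.1 * x.2.1.2) ≠ 0 := by
      intro x
      have : Q (x.1 * x.2.1.1, x.1 * x.2.1.2) = (x.1 : F) ^ 2 * Q x.2.1 := by
        simp only [Q]; ring
      rw [this, x.2.2, mul_one]
      exact pow_ne_zero _ x.1.ne_zero
    refine (Nat.card_congr (Equiv.ofBijective
      (fun x => ⟨(x.1 * x.2.1.1, x.1 * x.2.1.2), hQ x⟩) ⟨?_, ?_⟩)).symm
    · rintro ⟨u, ⟨p, hp⟩⟩ ⟨v, ⟨p', hp'⟩⟩ h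
      simp only [Subtype.mk.injEq, Prod.mk.injEq] at h
      have hQ : (u : F) ^ 2 * Q p = (v : F) ^ 2 * Q p' := by
        simp only [Q]
        linear_combination (u * p.1 + v * p'.1 + u * p.2 * t) * h.1 +
          (t * v * p'.1 + d * (u * p.2 + v * p'.2)) * h.2
      rw [hp, hp', mul_one, mul_one] at hQ
      have huv : u = v := Units.ext (CharTwo.sq_injective hQ)
      subst huv
      have h1 := mul_left_cancel₀ u.ne_zero h.1
      have h2 := mul_left_cancel₀ u.ne_zero h.2
      simp [Prod.ext_iff, h1, h2]
    · rintro ⟨p, hp⟩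
      obtain ⟨s, hs⟩ := exists_sq_eq (Q p)
      have hs0 : s ≠ 0 := by
        rintro rfl
        exact hp (by rw [← hs]; simp)
      refine ⟨⟨Units.mk0 s hs0, ⟨(s⁻¹ * p.1, s⁻¹ * p.2), ?_⟩⟩, ?_⟩
      · have : Q (s⁻¹ * p.1, s⁻¹ * p.2) = (s ^ 2)⁻¹ * Q p := by
          simp only [Q]; field_simp
        rw [this, hs, inv_mul_cancel₀ hp]
      · simp [hs0]
  -- A nonzero isotropic vector has b ≠ 0 and is b · (z, 1) for a root z; `none` stands for the
  -- origin.
  have e2 : Nat.card {p : F × F // Q p = 0} =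
      Nat.card (Option (Fˣ × {z : F // z ^ 2 + z * t + d = 0})) := by
    refine (Nat.card_congr (Equiv.ofBijective
      (fun x => match x with
        | none => ⟨(0, 0), by simp [Q]⟩
        | some x => ⟨(x.1 * x.2.1, x.1), by
            have := x.2.2
            simp only [Q]
            linear_combination (x.1 : F) ^ 2 * this⟩) ⟨?_, ?_⟩)).symm
    · rintro (_ | ⟨u, z, hz⟩) (_ | ⟨v, w, hw⟩) h
      · rfl
      · exact absurd (congrArg (fun x => x.1.2) h).symm v.ne_zero
      · exact absurd (congrArg (fun x => x.1.2) h) u.ne_zero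
      · simp only [Subtype.mk.injEq, Prod.mk.injEq] at h
        have huv : u = v := Units.ext h.2
        subst huv
        have := mul_left_cancel₀ u.ne_zero h.1
        simp [this]
    · rintro ⟨⟨a, b⟩, hp⟩
      by_cases hb : b = 0
      · subst hb
        have ha : a = 0 := by simpa [Q] using hp
        exact ⟨none, by simp [ha]⟩
      · refine ⟨some ⟨Units.mk0 b hb, ⟨a / b, ?_⟩⟩, ?_⟩
        · simp only [Q] at hp
          field_simp
          linear_combination hp
        · simp only [Units.val_mk0, Subtype.mk.injEq, Prod.mk.injEq, and_true]
          field_simp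
  have e3 : Nat.card (F × F) =
      Nat.card {p : F × F // Q p = 0} + Nat.card {p : F × F // Q p ≠ 0} := by
    rw [← Nat.card_sum]
    exact (Nat.card_congr (Equiv.sumCompl fun p : F × F => Q p = 0)).symm
  rw [e1, e2, Finite.card_option, Nat.card_prod, Nat.card_prod, Nat.card_prod, Nat.card_units] at e3
  have hq : 1 < Nat.card F := Finite.one_lt_card
  -- With q = m + 2 the factor q - 1 becomes m + 1, free of truncation, and is cancelled from (q -
  -- 1)(ones + roots) = q² - 1.
  obtain ⟨m, hm⟩ : ∃ m, Nat.card F = m + 2 := ⟨_, (Nat.sub_add_cancel hq).symm⟩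
  rw [hm] at e3 ⊢
  simp only [Nat.add_succ_sub_one] at e3
  refine Nat.eq_of_mul_eq_mul_left (Nat.succ_pos m) ?_
  rw [Nat.succ_eq_add_one]
  simp only [Q] at e3
  linear_combination -e3

/-- The polynomial z² + d has exactly one root, the square root of d. -/
theorem card_norm_one_of_eq_zero (d : F) :
    Nat.card {p : F × F // p.1 ^ 2 + p.1 * p.2 * 0 + p.2 ^ 2 * d = 1} = Nat.card F := by
  have h := card_norm_one_add_card_roots 0 d
  have : Nat.card {z : F // z ^ 2 + z * 0 + d = 0} = 1 := by
    rw [Nat.card_eq_one_iff_unique]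
    obtain ⟨s, hs⟩ := exists_sq_eq d
    refine ⟨⟨fun ⟨z, hz⟩ ⟨w, hw⟩ => Subtype.ext (CharTwo.sq_injective ?_)⟩, ⟨⟨s, ?_⟩⟩⟩
    · linear_combination hz - hw
    · rw [hs, mul_zero, add_zero, CharTwo.add_self_eq_zero]
  omega

/-- If z is a root of z² + t z + d, the other is z + t ≠ z, so there are either no roots or two: the
nonsplit and split cases. -/
theorem card_norm_one_of_ne_zero {t : F} (ht : t ≠ 0) (d : F) :
    Nat.card {p : F × F // p.1 ^ 2 + p.1 * p.2 * t + p.2 ^ 2 * d = 1} = Nat.card F + 1 ∨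
    Nat.card {p : F × F // p.1 ^ 2 + p.1 * p.2 * t + p.2 ^ 2 * d = 1} = Nat.card F - 1 := by
  have h := card_norm_one_add_card_roots t d
  rcases isEmpty_or_nonempty {z : F // z ^ 2 + z * t + d = 0} with h0 | ⟨⟨z, hz⟩⟩
  · rw [Nat.card_of_isEmpty (α := {z : F // z ^ 2 + z * t + d = 0})] at h
    omega
  · have : Nat.card {z : F // z ^ 2 + z * t + d = 0} = 2 := by
      rw [← Set.coe_ofPred, Nat.card_coe_set_eq, Set.ncard_eq_two]
      refine ⟨z, z + t, fun e => ht (by simpa using e), ?_⟩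
      have h2 : (2 : F) = 0 := CharTwo.two_eq_zero
      ext w
      simp only [Set.mem_ofPred_eq, Set.mem_insert_iff, Set.mem_singleton_iff]
      constructor
      · intro hw
        have : (w - z) * (w - (z + t)) = 0 := by
          linear_combination hw - hz + (z ^ 2 - w * t - w * z + z * t) * h2
        rcases mul_eq_zero.mp this with h | h
        · exact Or.inl (sub_eq_zero.mp h)
        · exact Or.inr (sub_eq_zero.mp h)
      · rintro (rfl | rfl)
        · exact hz
        · linear_combination hz + (z * t + t ^ 2) * h2
    omega

end QuadraticForm

open Matrix

/-! ### Commuting 2 × 2 matrices -/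

section NonScalar

variable {F : Type*} [Field F]

/-- A `2 × 2` matrix that is not a scalar matrix. -/
def NonScalar (x : Matrix (Fin 2) (Fin 2) F) : Prop :=
  ∀ a : F, x ≠ a • 1

/-- The combination `a + b x` of the identity and a matrix `x`. -/
def affine (x : Matrix (Fin 2) (Fin 2) F) (p : F × F) : Matrix (Fin 2) (Fin 2) F :=
  p.1 • 1 + p.2 • x

theorem commute_affine (x : Matrix (Fin 2) (Fin 2) F) (p : F × F) : Commute x (affine x p) :=
  ((Commute.one_right x).smul_right _).add_right ((Commute.refl x).smul_right _)

theorem affine_injective {x : Matrix (Fin 2) (Fin 2) F} (hx : NonScalar x) :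
    Function.Injective (affine x) := by
  rintro ⟨a, b⟩ ⟨a', b'⟩ h
  have hb : b = b' := by
    by_contra hb
    have hb' : b - b' ≠ 0 := sub_ne_zero.mpr hb
    have h1 : (b - b') • x = (a' - a) • 1 := by
      simp only [affine] at h
      rw [sub_smul, sub_smul, sub_eq_sub_iff_add_eq_add, add_comm, h, add_comm]
    refine hx ((b - b')⁻¹ * (a' - a)) ?_
    rw [mul_smul, ← h1, smul_smul, inv_mul_cancel₀ hb', one_smul]
  subst hb
  simp only [affine, add_left_inj] at h
  have := congrFun (congrFun h 0) 0
  simpa using this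

theorem nonScalar_affine_iff {x : Matrix (Fin 2) (Fin 2) F} (hx : NonScalar x) (p : F × F) :
    NonScalar (affine x p) ↔ p.2 ≠ 0 := by
  constructor
  · intro h h0
    exact h p.1 (by simp [affine, h0])
  · intro h a ha
    have : affine x p = affine x (a, 0) := ha.trans (by simp [affine])
    exact h (congrArg Prod.snd (affine_injective hx this))

theorem det_affine (x : Matrix (Fin 2) (Fin 2) F) (p : F × F) :
    (affine x p).det = p.1 ^ 2 + p.1 * p.2 * x.trace + p.2 ^ 2 * x.det := by
  simp [affine, det_fin_two, trace_fin_two]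
  ring

/-- A matrix commuting with a nonscalar `2 × 2` matrix `x` lies in the span of `1` and `x`. -/
theorem exists_affine_of_commute {x y : Matrix (Fin 2) (Fin 2) F} (hx : NonScalar x)
    (h : Commute x y) : ∃ p, affine x p = y := by
  have h00 := congrFun (congrFun h.eq 0) 0
  have h01 := congrFun (congrFun h.eq 0) 1
  have h10 := congrFun (congrFun h.eq 1) 0
  simp only [mul_apply, Fin.sum_univ_two] at h00 h01 h10
  have hext : ∀ a b : F, a + b * x 0 0 = y 0 0 → b * x 0 1 = y 0 1 → b * x 1 0 = y 1 0 →
      a + b * x 1 1 = y 1 1 → affine x (a, b) = y := by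
    intro a b h1 h2 h3 h4
    ext i j
    fin_cases i <;> fin_cases j <;> simp [affine, h1, h2, h3, h4]
  by_cases c01 : x 0 1 = 0
  · by_cases c10 : x 1 0 = 0
    · have cd : x 0 0 - x 1 1 ≠ 0 := by
        intro hd
        refine hx (x 0 0) ?_
        ext i j
        fin_cases i <;> fin_cases j <;> simp [c01, c10]
        exact (sub_eq_zero.mp hd).symm
      refine ⟨(y 0 0 - (y 0 0 - y 1 1) / (x 0 0 - x 1 1) * x 0 0,
        (y 0 0 - y 1 1) / (x 0 0 - x 1 1)), hext _ _ (by ring) ?_ ?_ ?_⟩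
      · rw [c01, mul_zero, eq_comm]
        refine (mul_eq_zero.mp ?_).resolve_left cd
        rw [c01] at h01
        linear_combination h01
      · rw [c10, mul_zero, eq_comm]
        refine (mul_eq_zero.mp ?_).resolve_left cd
        rw [c10] at h10
        linear_combination -h10
      · field_simp
        ring
    · refine ⟨(y 0 0 - y 1 0 / x 1 0 * x 0 0, y 1 0 / x 1 0), hext _ _ (by ring) ?_ ?_ ?_⟩
      · field_simp
        linear_combination h00
      · field_simp
      · field_simp
        linear_combination h10
  · refine ⟨(y 0 0 - y 0 1 / x 0 1 * x 0 0, y 0 1 / x 0 1), hext _ _ (by ring) ?_ ?_ ?_⟩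
    · field_simp
    · field_simp
      linear_combination -h00
    · field_simp
      linear_combination -h01

/-- Commuting is transitive through a nonscalar `2 × 2` matrix. -/
theorem commute_trans {x y z : Matrix (Fin 2) (Fin 2) F} (hx : NonScalar x)
    (hy : Commute x y) (hz : Commute x z) : Commute y z := by
  obtain ⟨p, rfl⟩ := exists_affine_of_commute hx hy
  exact ((Commute.one_left z).smul_left _).add_left (hz.smul_left _)

variable (F) in
theorem card_nonScalar [Finite F] :
    Nat.card {x : Matrix (Fin 2) (Fin 2) F // NonScalar x} + Nat.card F = Nat.card F ^ 4 := by
  classical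
  have h1 : Nat.card (Matrix (Fin 2) (Fin 2) F) = Nat.card F ^ 4 := by
    rw [Matrix, Nat.card_fun, Nat.card_fun, ← pow_mul, Nat.card_fin]
  have h2 : Nat.card {x : Matrix (Fin 2) (Fin 2) F // ¬ NonScalar x} = Nat.card F := by
    refine (Nat.card_congr (Equiv.ofBijective
      (fun a : F => ⟨a • 1, fun h => h a rfl⟩) ⟨?_, ?_⟩)).symm
    · intro a b h
      have := congrFun (congrFun (congrArg Subtype.val h) 0) 0
      simpa using this
    · rintro ⟨x, hx⟩
      simp only [NonScalar, not_forall, not_not] at hx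
      obtain ⟨a, rfl⟩ := hx
      exact ⟨a, rfl⟩
  rw [← h1, ← Nat.card_congr (Equiv.sumCompl fun x : Matrix (Fin 2) (Fin 2) F => NonScalar x),
    Nat.card_sum, h2]

/-- The matrices commuting with a nonscalar matrix, other than the scalars. -/
theorem card_nonScalar_commute [Finite F] {x : Matrix (Fin 2) (Fin 2) F} (hx : NonScalar x) :
    Nat.card {y : Matrix (Fin 2) (Fin 2) F // NonScalar y ∧ Commute x y} =
      Nat.card F * (Nat.card F - 1) := by
  rw [← Nat.card_units, ← Nat.card_prod]
  refine (Nat.card_congr (Equiv.ofBijective (fun p : F × Fˣ =>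
    ⟨affine x (p.1, p.2), (nonScalar_affine_iff hx _).mpr p.2.ne_zero, commute_affine x _⟩)
    ⟨?_, ?_⟩)).symm
  · rintro ⟨a, b⟩ ⟨a', b'⟩ h
    have := affine_injective hx (congrArg Subtype.val h)
    simp only [Prod.mk.injEq] at this
    exact Prod.ext this.1 (Units.ext this.2)
  · rintro ⟨y, hy, hxy⟩
    obtain ⟨p, rfl⟩ := exists_affine_of_commute hx hxy
    exact ⟨(p.1, Units.mk0 p.2 ((nonScalar_affine_iff hx p).mp hy)), rfl⟩

/-- The subgroup of `SL₂` of the elements commuting with a given matrix. -/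
def commutingSubgroup (y : Matrix (Fin 2) (Fin 2) F) : Subgroup (Matrix.SpecialLinearGroup (Fin 2) F) where
  carrier := {g | Commute y (g : Matrix (Fin 2) (Fin 2) F)}
  one_mem' := by simp
  mul_mem' ha hb := by
    simpa using ha.mul_right hb
  inv_mem' {g} hg := by
    have h1 : (g : Matrix (Fin 2) (Fin 2) F) * (g⁻¹ : Matrix.SpecialLinearGroup (Fin 2) F) = 1 := by
      rw [← Matrix.SpecialLinearGroup.coe_mul, mul_inv_cancel, Matrix.SpecialLinearGroup.coe_one]
    have h2 : ((g⁻¹ : Matrix.SpecialLinearGroup (Fin 2) F) : Matrix (Fin 2) (Fin 2) F) * g = 1 := by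
      rw [← Matrix.SpecialLinearGroup.coe_mul, inv_mul_cancel, Matrix.SpecialLinearGroup.coe_one]
    exact Commute.units_inv_right (u := ⟨g.1, _, h1, h2⟩) hg

theorem mem_commutingSubgroup {y : Matrix (Fin 2) (Fin 2) F} {g : Matrix.SpecialLinearGroup (Fin 2) F} :
    g ∈ commutingSubgroup y ↔ Commute y (g : Matrix (Fin 2) (Fin 2) F) :=
  Iff.rfl

theorem centralizer_eq_commutingSubgroup (x : Matrix.SpecialLinearGroup (Fin 2) F) :
    Subgroup.centralizer {x} = commutingSubgroup (x : Matrix (Fin 2) (Fin 2) F) := by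
  ext g
  rw [Subgroup.mem_centralizer_singleton_iff, mem_commutingSubgroup, commute_iff_eq,
    ← Matrix.SpecialLinearGroup.coe_mul, ← Matrix.SpecialLinearGroup.coe_mul]
  exact ⟨fun h => congrArg Subtype.val h.symm, fun h => (Subtype.ext h).symm⟩

/-- Commuting nonscalar matrices have the same commuting subgroup. -/
theorem commutingSubgroup_eq {x y : Matrix (Fin 2) (Fin 2) F} (hx : NonScalar x)
    (hy : NonScalar y) (h : Commute x y) : commutingSubgroup x = commutingSubgroup y := by
  ext g
  exact ⟨fun hg => commute_trans hx h hg, fun hg => commute_trans hy h.symm hg⟩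

/-- Each element is `a + b y` for a unique pair (a, b), and the quadratic form is its determinant.
-/
theorem card_commutingSubgroup {y : Matrix (Fin 2) (Fin 2) F} (hy : NonScalar y) :
    Nat.card (commutingSubgroup y) =
      Nat.card {p : F × F // p.1 ^ 2 + p.1 * p.2 * y.trace + p.2 ^ 2 * y.det = 1} := by
  refine (Nat.card_congr (Equiv.ofBijective (fun p =>
    ⟨⟨affine y p.1, (det_affine y p.1).trans p.2⟩, commute_affine y p.1⟩) ⟨?_, ?_⟩)).symm
  · intro p p' h
    exact Subtype.ext (affine_injective hy (congrArg (fun g => g.1.1) h))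
  · rintro ⟨g, hg⟩
    obtain ⟨p, hp⟩ := exists_affine_of_commute hy hg
    refine ⟨⟨p, ?_⟩, Subtype.ext (Subtype.ext hp)⟩
    rw [← det_affine, hp, g.2]

end NonScalar

/-! ### SL₂ in characteristic two -/

section CharTwo

variable {F : Type*} [Field F] [CharP F 2]

/-- A scalar a of determinant 1 satisfies a² = 1, which forces a = 1 in characteristic two. -/
theorem nonScalar_iff_ne_one (x : Matrix.SpecialLinearGroup (Fin 2) F) :
    NonScalar (x : Matrix (Fin 2) (Fin 2) F) ↔ x ≠ 1 := by
  constructor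
  · rintro h rfl
    exact h 1 (by simp)
  · intro h a ha
    have hdet := x.2
    rw [ha, det_smul, det_one, mul_one, Fintype.card_fin] at hdet
    have h1 : a = 1 := CharTwo.sq_injective (by simpa using hdet)
    exact h (Subtype.ext (by rw [ha, h1, one_smul]; rfl))

variable (F) in
/-- The special linear group `SL₂` in characteristic two has trivial center. -/
theorem center_SL_eq_bot : Subgroup.center (Matrix.SpecialLinearGroup (Fin 2) F) = ⊥ := by
  refine (Subgroup.eq_bot_iff_forall _).mpr fun x hx => ?_
  obtain ⟨r, -, hr⟩ := Matrix.SpecialLinearGroup.mem_center_iff.mp hx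
  by_contra h
  refine (nonScalar_iff_ne_one x).mpr h r ?_
  rw [← hr, smul_one_eq_diagonal]
  rfl

/-- Otherwise transitivity of commuting through y would make SL₂ abelian, against the trivial center
and the existence of a transvection. -/
theorem commutingSubgroup_ne_top {y : Matrix (Fin 2) (Fin 2) F} (hy : NonScalar y) :
    commutingSubgroup y ≠ ⊤ := by
  intro h
  have hcomm : ∀ g : Matrix.SpecialLinearGroup (Fin 2) F, g ∈ Subgroup.center _ := by
    intro g
    refine Subgroup.mem_center_iff.mpr fun g' => Subtype.ext ?_
    have h1 : g ∈ commutingSubgroup y := h ▸ Subgroup.mem_top g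
    have h2 : g' ∈ commutingSubgroup y := h ▸ Subgroup.mem_top g'
    exact (commute_trans hy h2 h1).eq
  have h1 := hcomm ⟨!![1, 1; 0, 1], by simp⟩
  rw [center_SL_eq_bot] at h1
  replace h1 := Subgroup.mem_bot.mp h1
  have := congrFun (congrFun (congrArg Subtype.val h1) 0) 1
  simp at this

variable [Finite F]

theorem card_commutingSubgroup_of_trace_eq_zero {y : Matrix (Fin 2) (Fin 2) F} (hy : NonScalar y)
    (ht : y.trace = 0) : Nat.card (commutingSubgroup y) = Nat.card F := by
  rw [card_commutingSubgroup hy, ht, card_norm_one_of_eq_zero]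

theorem card_commutingSubgroup_of_trace_ne_zero {y : Matrix (Fin 2) (Fin 2) F} (hy : NonScalar y)
    (ht : y.trace ≠ 0) : Nat.card (commutingSubgroup y) = Nat.card F + 1 ∨
      Nat.card (commutingSubgroup y) = Nat.card F - 1 := by
  rw [card_commutingSubgroup hy]
  exact card_norm_one_of_ne_zero ht _

theorem card_commutingSubgroup_eq_iff {y : Matrix (Fin 2) (Fin 2) F} (hy : NonScalar y) :
    Nat.card (commutingSubgroup y) = Nat.card F ↔ y.trace = 0 := by
  refine ⟨fun h => ?_, card_commutingSubgroup_of_trace_eq_zero hy⟩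
  by_contra ht
  have hq : 1 < Nat.card F := Finite.one_lt_card
  rcases card_commutingSubgroup_of_trace_ne_zero hy ht with h' | h' <;> omega

-- Dividing an invertible matrix by the unique square root of its determinant identifies GL₂, as a
-- set, with Fˣ × SL₂.
variable (F) in
theorem card_SL : Nat.card (Matrix.SpecialLinearGroup (Fin 2) F) + Nat.card F = Nat.card F ^ 3 := by
  classical
  have := Fintype.ofFinite F
  have hGL := card_GL_field (𝔽 := F) 2
  have hiso : Nat.card (GL (Fin 2) F) = Nat.card (Fˣ × Matrix.SpecialLinearGroup (Fin 2) F) := by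
    have hdet : ∀ x : Fˣ × Matrix.SpecialLinearGroup (Fin 2) F,
        ((x.1 : F) • (x.2 : Matrix (Fin 2) (Fin 2) F)).det = (x.1 : F) ^ 2 := by
      intro x
      rw [det_smul, x.2.2, mul_one, Fintype.card_fin]
    refine (Nat.card_congr (Equiv.ofBijective (fun x =>
      GeneralLinearGroup.mkOfDetNeZero ((x.1 : F) • (x.2 : Matrix (Fin 2) (Fin 2) F))
        (by rw [hdet]; exact pow_ne_zero _ x.1.ne_zero)) ⟨?_, ?_⟩)).symm
    · rintro ⟨u, g⟩ ⟨v, h⟩ e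
      have e' : (u : F) • (g : Matrix (Fin 2) (Fin 2) F) = (v : F) • (h : Matrix _ _ F) :=
        congrArg Units.val e
      have huv : u = v := Units.ext (CharTwo.sq_injective
        ((hdet (u, g)).symm.trans ((congrArg det e').trans (hdet (v, h)))))
      subst huv
      have := smul_right_injective _ u.ne_zero e'
      rw [Subtype.ext this]
    · intro g
      obtain ⟨s, hs⟩ := exists_sq_eq (g : Matrix (Fin 2) (Fin 2) F).det
      have hg : (g : Matrix (Fin 2) (Fin 2) F).det ≠ 0 := GeneralLinearGroup.det_ne_zero g
      have hs0 : s ≠ 0 := by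
        rintro rfl
        exact hg (by rw [← hs]; simp)
      refine ⟨(Units.mk0 s hs0, ⟨s⁻¹ • (g : Matrix (Fin 2) (Fin 2) F), ?_⟩), Units.ext ?_⟩
      · rw [det_smul, Fintype.card_fin, ← hs, ← mul_pow, inv_mul_cancel₀ hs0, one_pow]
      · change s • s⁻¹ • (g : Matrix (Fin 2) (Fin 2) F) = g
        rw [smul_smul, mul_inv_cancel₀ hs0, one_smul]
  rw [hiso, Nat.card_prod, Nat.card_units, Fin.prod_univ_two, ← Nat.card_eq_fintype_card] at hGL
  have hq : 1 < Nat.card F := Finite.one_lt_card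
  obtain ⟨m, hm⟩ : ∃ m, Nat.card F = m + 2 := ⟨_, (Nat.sub_add_cancel hq).symm⟩
  rw [hm] at hGL ⊢
  have h0 : (m + 2) ^ 2 - (m + 2) ^ ((0 : Fin 2) : ℕ) = (m + 1) * (m + 3) := by
    rw [Nat.sub_eq_iff_eq_add (by simpa using Nat.one_le_pow _ _ (by omega))]
    simp
    ring
  have h1 : (m + 2) ^ 2 - (m + 2) ^ ((1 : Fin 2) : ℕ) = (m + 2) * (m + 1) := by
    rw [Nat.sub_eq_iff_eq_add (by simpa using Nat.le_self_pow (by omega) _)]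
    simp
    ring
  rw [h0, h1, Nat.add_succ_sub_one, mul_assoc] at hGL
  rw [Nat.eq_of_mul_eq_mul_left (Nat.succ_pos m) hGL]
  ring

variable (F) in
/-- The number of trace zero elements of `SL₂` other than the identity. -/
theorem card_trace_eq_zero :
    Nat.card {x : Matrix.SpecialLinearGroup (Fin 2) F //
      x ≠ 1 ∧ (x : Matrix (Fin 2) (Fin 2) F).trace = 0} + 1 = Nat.card F ^ 2 := by
  classical
  -- Trace zero means equal diagonal entries s, and s² = 1 + bc determines s from arbitrary
  -- off-diagonal entries b, c.
  have h1 : Nat.card {x : Matrix.SpecialLinearGroup (Fin 2) F //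
      (x : Matrix (Fin 2) (Fin 2) F).trace = 0} = Nat.card (F × F) := by
    refine Nat.card_congr (Equiv.ofBijective (fun x => (x.1 0 1, x.1 1 0)) ⟨?_, ?_⟩)
    · rintro ⟨x, hx⟩ ⟨y, hy⟩ h
      simp only [Prod.mk.injEq] at h
      have hxd := x.2
      have hyd := y.2
      rw [det_fin_two] at hxd hyd
      rw [trace_fin_two, CharTwo.add_eq_zero] at hx hy
      have hd : x 0 0 = y 0 0 := by
        apply CharTwo.sq_injective
        change x 0 0 ^ 2 = y 0 0 ^ 2
        have h01 : x.1 0 1 = y.1 0 1 := h.1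
        have h10 : x.1 1 0 = y.1 1 0 := h.2
        rw [← hx, h01, h10] at hxd
        rw [← hy] at hyd
        change x.1 0 0 ^ 2 = y.1 0 0 ^ 2
        linear_combination hxd - hyd
      refine Subtype.ext (Subtype.ext ?_)
      ext i j
      fin_cases i <;> fin_cases j
      · exact hd
      · exact h.1
      · exact h.2
      · exact hx.symm.trans (hd.trans hy)
    · rintro ⟨b, c⟩
      obtain ⟨s, hs⟩ := exists_sq_eq (1 + b * c)
      refine ⟨⟨⟨!![s, b; c, s], ?_⟩, ?_⟩, ?_⟩
      · rw [det_fin_two_of]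
        linear_combination hs
      · simp [trace_fin_two, CharTwo.add_self_eq_zero]
      · simp
  let f : Option {x : Matrix.SpecialLinearGroup (Fin 2) F //
        x ≠ 1 ∧ (x : Matrix (Fin 2) (Fin 2) F).trace = 0} →
      {x : Matrix.SpecialLinearGroup (Fin 2) F // (x : Matrix (Fin 2) (Fin 2) F).trace = 0}
    | none => ⟨1, by
        rw [Matrix.SpecialLinearGroup.coe_one, trace_fin_two]
        exact CharTwo.add_self_eq_zero _⟩
    | some y => ⟨y.1, y.2.2⟩
  have hf : Function.Bijective f := by
    constructor
    · rintro (_ | ⟨x, hx⟩) (_ | ⟨y, hy⟩) h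
      · rfl
      · exact absurd (congrArg Subtype.val h).symm hy.1
      · exact absurd (congrArg Subtype.val h) hx.1
      · exact congrArg some (Subtype.ext (congrArg Subtype.val h :))
    · rintro ⟨x, hx⟩
      by_cases h : x = 1
      · exact ⟨none, Subtype.ext h.symm⟩
      · exact ⟨some ⟨x, h, hx⟩, rfl⟩
  rw [← Finite.card_option, Nat.card_congr (Equiv.ofBijective f hf), h1, Nat.card_prod, sq]

end CharTwo

/-! ### Counting the proper centralizers of SL₂ -/

section Count

variable {F : Type*} [Field F] [CharP F 2]

instance [Finite F] : Finite (Matrix.SpecialLinearGroup (Fin 2) F) :=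
  inferInstanceAs (Finite {A : Matrix (Fin 2) (Fin 2) F // A.det = 1})

theorem exists_eq_commutingSubgroup
    (H : ProperCentralizer (Matrix.SpecialLinearGroup (Fin 2) F)) :
    ∃ x : Matrix.SpecialLinearGroup (Fin 2) F,
      NonScalar (x : Matrix (Fin 2) (Fin 2) F) ∧ H.1 = commutingSubgroup x.1 := by
  obtain ⟨⟨x, hx⟩, htop⟩ := H.2
  refine ⟨x, (nonScalar_iff_ne_one x).mpr ?_, hx.trans (centralizer_eq_commutingSubgroup x)⟩
  rintro rfl
  refine htop (hx.trans (Subgroup.centralizer_eq_top_iff_subset.mpr ?_))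
  simp

/-- The proper centralizer of a nonidentity element of `SL₂`. -/
def centralizerOf (x : Matrix.SpecialLinearGroup (Fin 2) F) (hx : x ≠ 1) :
    ProperCentralizer (Matrix.SpecialLinearGroup (Fin 2) F) :=
  ⟨commutingSubgroup x.1, ⟨x, (centralizer_eq_commutingSubgroup x).symm⟩,
    commutingSubgroup_ne_top ((nonScalar_iff_ne_one x).mpr hx)⟩

/-- The nonidentity elements with a given centralizer `H` are the nonidentity elements of `H`. -/
theorem centralizerOf_eq_iff {x : Matrix.SpecialLinearGroup (Fin 2) F} (hx : x ≠ 1)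
    (H : ProperCentralizer (Matrix.SpecialLinearGroup (Fin 2) F)) :
    centralizerOf x hx = H ↔ x ∈ H.1 := by
  obtain ⟨z, hz, hH⟩ := exists_eq_commutingSubgroup H
  constructor
  · rintro rfl
    exact Commute.refl _
  · intro h
    rw [hH] at h
    exact Subtype.ext
      ((commutingSubgroup_eq hz ((nonScalar_iff_ne_one x).mpr hx) h).symm.trans hH.symm)

variable [Finite F]

theorem card_properCentralizer_cases
    (H : ProperCentralizer (Matrix.SpecialLinearGroup (Fin 2) F)) :
    Nat.card H.1 = Nat.card F ∨ Nat.card H.1 = Nat.card F - 1 ∨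
      Nat.card H.1 = Nat.card F + 1 := by
  obtain ⟨x, hx, h⟩ := exists_eq_commutingSubgroup H
  rw [h]
  by_cases ht : trace x.1 = 0
  · exact Or.inl (card_commutingSubgroup_of_trace_eq_zero hx ht)
  · exact Or.inr (card_commutingSubgroup_of_trace_ne_zero hx ht).symm

theorem card_subgroup_ne_one {G : Type*} [Group G] [Finite G] (H : Subgroup G) :
    Nat.card {x : G // x ≠ 1 ∧ x ∈ H} + 1 = Nat.card H := by
  classical
  have e : {x : G // x ≠ 1 ∧ x ∈ H} ≃ {x : H // ¬ x = 1} :=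
    { toFun := fun x => ⟨⟨x.1, x.2.2⟩, fun h => x.2.1 (congrArg Subtype.val h)⟩
      invFun := fun x => ⟨x.1.1, fun h => x.2 (Subtype.ext h), x.1.2⟩
      left_inv := fun _ => rfl
      right_inv := fun _ => rfl }
  rw [Nat.card_congr e, ← Nat.card_congr (Equiv.sumCompl fun x : H => x = 1), Nat.card_sum,
    Nat.card_unique (α := {x : H // x = 1}), add_comm]

variable (F) in
/-- Every nonidentity element of `SL₂` lies in exactly one proper centralizer. -/
theorem sum_card_properCentralizer :
    ∑ H : ProperCentralizer (Matrix.SpecialLinearGroup (Fin 2) F), (Nat.card H.1 - 1) + 1 =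
      Nat.card (Matrix.SpecialLinearGroup (Fin 2) F) := by
  have h := card_subgroup_ne_one (⊤ : Subgroup (Matrix.SpecialLinearGroup (Fin 2) F))
  rw [Subgroup.card_top] at h
  rw [← h, Nat.card_congr (Equiv.sigmaFiberEquiv fun x : {x : Matrix.SpecialLinearGroup (Fin 2) F //
    x ≠ 1 ∧ x ∈ (⊤ : Subgroup (Matrix.SpecialLinearGroup (Fin 2) F))} =>
      centralizerOf x.1 x.2.1).symm, Nat.card_sigma]
  congr 1
  refine Finset.sum_congr rfl fun H _ => ?_
  rw [← card_subgroup_ne_one H.1, Nat.add_sub_cancel]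
  exact Nat.card_congr
    { toFun := fun x => ⟨⟨x.1, x.2.1, Subgroup.mem_top _⟩, (centralizerOf_eq_iff x.2.1 H).mpr x.2.2⟩
      invFun := fun x => ⟨x.1.1, x.1.2.1, (centralizerOf_eq_iff x.1.2.1 H).mp x.2⟩
      left_inv := fun _ => rfl
      right_inv := fun _ => rfl }

variable (F) in
/-- The involutions of `SL₂` are partitioned by the proper centralizers of order `q`. -/
theorem card_properCentralizer_card_eq_mul :
    Nat.card {H : ProperCentralizer (Matrix.SpecialLinearGroup (Fin 2) F) //
      Nat.card H.1 = Nat.card F} * (Nat.card F - 1) + 1 = Nat.card F ^ 2 := by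
  rw [← card_trace_eq_zero F, Nat.card_congr (Equiv.sigmaFiberEquiv
    fun x : {x : Matrix.SpecialLinearGroup (Fin 2) F //
      x ≠ 1 ∧ (x : Matrix (Fin 2) (Fin 2) F).trace = 0} =>
    (⟨centralizerOf x.1 x.2.1, card_commutingSubgroup_of_trace_eq_zero
      ((nonScalar_iff_ne_one x.1).mpr x.2.1) x.2.2⟩ :
      {H : ProperCentralizer (Matrix.SpecialLinearGroup (Fin 2) F) //
        Nat.card H.1 = Nat.card F})).symm]
  have := Fintype.ofFinite {H : ProperCentralizer (Matrix.SpecialLinearGroup (Fin 2) F) //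
        Nat.card H.1 = Nat.card F}
  rw [Nat.card_sigma, Finset.sum_congr rfl (g := fun _ => Nat.card F - 1)]
  · rw [Finset.sum_const, Finset.card_univ, ← Nat.card_eq_fintype_card, smul_eq_mul]
  · rintro ⟨H, hH⟩ -
    rw [eq_tsub_of_add_eq ((card_subgroup_ne_one H.1).trans hH) |>.symm]
    refine Nat.card_congr
      { toFun := fun x => ⟨x.1.1, x.1.2.1,
          (centralizerOf_eq_iff x.1.2.1 H).mp (congrArg Subtype.val x.2)⟩
        invFun := fun x => ⟨⟨x.1, x.2.1, ?_⟩,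
          Subtype.ext ((centralizerOf_eq_iff x.2.1 H).mpr x.2.2)⟩
        left_inv := fun _ => rfl
        right_inv := fun _ => rfl }
    -- A nonidentity element of H has centralizer H, whose order q forces trace zero.
    refine (card_commutingSubgroup_eq_iff ((nonScalar_iff_ne_one x.1).mpr x.2.1)).mp ?_
    refine Eq.trans ?_ hH
    exact congrArg (fun K : ProperCentralizer _ => Nat.card K.1)
      ((centralizerOf_eq_iff x.2.1 H).mpr x.2.2)

/-- The bound q > 2 excludes the split case of order q - 1 = 1, where the nonscalar matrix would cut
out only the identity. -/
theorem exists_mem_commutingSubgroup_ne_one (hq : 2 < Nat.card F)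
    {y : Matrix (Fin 2) (Fin 2) F} (hy : NonScalar y) : ∃ x ∈ commutingSubgroup y, x ≠ 1 := by
  have hcard : 1 < Nat.card (commutingSubgroup y) := by
    by_cases ht : trace y = 0
    · rw [card_commutingSubgroup_of_trace_eq_zero hy ht]
      omega
    · rcases card_commutingSubgroup_of_trace_ne_zero hy ht with h | h <;> omega
  obtain ⟨x, hx⟩ := Subgroup.ne_bot_iff_exists_ne_one.mp
    ((Subgroup.one_lt_card_iff_ne_bot _).mp hcard)
  exact ⟨x.1, x.2, fun h => hx (Subtype.ext h)⟩

/-- The proper centralizer cut out on `SL₂` by a nonscalar matrix. -/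
def centralizerOfMatrix (hq : 2 < Nat.card F) (y : Matrix (Fin 2) (Fin 2) F) (hy : NonScalar y) :
    ProperCentralizer (Matrix.SpecialLinearGroup (Fin 2) F) :=
  ⟨commutingSubgroup y, by
    obtain ⟨x, hx, hx1⟩ := exists_mem_commutingSubgroup_ne_one hq hy
    exact ⟨x, (commutingSubgroup_eq hy ((nonScalar_iff_ne_one x).mpr hx1) hx).trans
      (centralizer_eq_commutingSubgroup x).symm⟩, commutingSubgroup_ne_top hy⟩

/-- The nonscalar matrices are partitioned by the proper centralizers. -/
theorem card_properCentralizer_mul (hq : 2 < Nat.card F) :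
    Nat.card (ProperCentralizer (Matrix.SpecialLinearGroup (Fin 2) F)) *
      (Nat.card F * (Nat.card F - 1)) + Nat.card F = Nat.card F ^ 4 := by
  rw [← card_nonScalar F, Nat.card_congr (Equiv.sigmaFiberEquiv
    fun y : {y : Matrix (Fin 2) (Fin 2) F // NonScalar y} =>
      centralizerOfMatrix hq y.1 y.2).symm, Nat.card_sigma,
    Finset.sum_congr rfl (g := fun _ => Nat.card F * (Nat.card F - 1))]
  · rw [Finset.sum_const, Finset.card_univ, ← Nat.card_eq_fintype_card, smul_eq_mul]
  -- The fibre over H = C(x) is the plane F[x] without the scalars.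
  · intro H _
    obtain ⟨x, hx, hH⟩ := exists_eq_commutingSubgroup H
    rw [← card_nonScalar_commute hx]
    refine Nat.card_congr
      { toFun := fun y => ⟨y.1.1, y.1.2, ?_⟩
        invFun := fun y => ⟨⟨y.1, y.2.1⟩, Subtype.ext
          ((commutingSubgroup_eq hx y.2.1 y.2.2).symm.trans hH.symm)⟩
        left_inv := fun _ => rfl
        right_inv := fun _ => rfl }
    have h1 : commutingSubgroup y.1.1 = commutingSubgroup x.1 :=
      (congrArg Subtype.val y.2).trans hH
    have h2 : x ∈ commutingSubgroup y.1.1 := h1 ▸ (Commute.refl x.1 : x ∈ commutingSubgroup x.1)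
    exact Commute.symm h2

/-- Let A, B, C count the centralizers of order q, q - 1, q + 1. Trace zero elements give A(q - 1) =
q² - 1, nonscalar matrices give (A + B + C)(q² - q) = q⁴ - q, and nonidentity elements of SL₂ give
A(q - 1) + B(q - 2) + Cq = q³ - q - 1. This system has a unique solution. -/
theorem card_properCentralizer_card_eq (hq : 2 < Nat.card F) :
    Nat.card {H : ProperCentralizer (Matrix.SpecialLinearGroup (Fin 2) F) //
      Nat.card H.1 = Nat.card F} = Nat.card F + 1 ∧
    2 * Nat.card {H : ProperCentralizer (Matrix.SpecialLinearGroup (Fin 2) F) //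
      Nat.card H.1 = Nat.card F - 1} = Nat.card F * (Nat.card F + 1) ∧
    2 * Nat.card {H : ProperCentralizer (Matrix.SpecialLinearGroup (Fin 2) F) //
      Nat.card H.1 = Nat.card F + 1} = Nat.card F * (Nat.card F - 1) := by
  classical
  have e1 := card_properCentralizer_card_eq_mul F
  have e2 := card_properCentralizer_mul hq
  have e3 := sum_card_properCentralizer F
  have e4 := card_SL F
  obtain ⟨m, hm⟩ : ∃ m, Nat.card F = m + 2 := ⟨_, (Nat.sub_add_cancel hq.le).symm⟩
  have hind : ∀ s, Nat.card {H : ProperCentralizer (Matrix.SpecialLinearGroup (Fin 2) F) //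
      Nat.card H.1 = s} =
      ∑ H : ProperCentralizer (Matrix.SpecialLinearGroup (Fin 2) F),
        if Nat.card H.1 = s then 1 else 0 := by
    intro s
    rw [Finset.sum_boole, Nat.card_eq_fintype_card, Fintype.card_subtype, Nat.cast_id]
  have t1 : Nat.card (ProperCentralizer (Matrix.SpecialLinearGroup (Fin 2) F)) =
      Nat.card {H : ProperCentralizer (Matrix.SpecialLinearGroup (Fin 2) F) //
        Nat.card H.1 = Nat.card F} +
      Nat.card {H : ProperCentralizer (Matrix.SpecialLinearGroup (Fin 2) F) //
        Nat.card H.1 = Nat.card F - 1} +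
      Nat.card {H : ProperCentralizer (Matrix.SpecialLinearGroup (Fin 2) F) //
        Nat.card H.1 = Nat.card F + 1} := by
    rw [hind, hind, hind, ← Finset.sum_add_distrib, ← Finset.sum_add_distrib,
      Nat.card_eq_fintype_card, Fintype.card_eq_sum_ones]
    refine Finset.sum_congr rfl fun H _ => ?_
    have := card_properCentralizer_cases H
    split_ifs <;> omega
  have t2 : ∑ H : ProperCentralizer (Matrix.SpecialLinearGroup (Fin 2) F), (Nat.card H.1 - 1) =
      (m + 1) * Nat.card {H : ProperCentralizer (Matrix.SpecialLinearGroup (Fin 2) F) //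
        Nat.card H.1 = Nat.card F} +
      m * Nat.card {H : ProperCentralizer (Matrix.SpecialLinearGroup (Fin 2) F) //
        Nat.card H.1 = Nat.card F - 1} +
      (m + 2) * Nat.card {H : ProperCentralizer (Matrix.SpecialLinearGroup (Fin 2) F) //
        Nat.card H.1 = Nat.card F + 1} := by
    rw [hind, hind, hind, Finset.mul_sum, Finset.mul_sum, Finset.mul_sum,
      ← Finset.sum_add_distrib, ← Finset.sum_add_distrib]
    refine Finset.sum_congr rfl fun H _ => ?_
    simp only [mul_ite, mul_one, mul_zero]
    have := card_properCentralizer_cases H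
    split_ifs <;> omega
  rw [t1] at e2
  rw [t2] at e3
  generalize Nat.card {H : ProperCentralizer (Matrix.SpecialLinearGroup (Fin 2) F) //
    Nat.card H.1 = Nat.card F} = A at *
  generalize Nat.card {H : ProperCentralizer (Matrix.SpecialLinearGroup (Fin 2) F) //
    Nat.card H.1 = Nat.card F - 1} = B at *
  generalize Nat.card {H : ProperCentralizer (Matrix.SpecialLinearGroup (Fin 2) F) //
    Nat.card H.1 = Nat.card F + 1} = C at *
  rw [← e3] at e4
  simp only [hm, Nat.add_succ_sub_one] at e1 e2 e4 ⊢
  have hA : A = m + 3 := by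
    refine Nat.eq_of_mul_eq_mul_left (Nat.succ_pos m) ?_
    rw [Nat.succ_eq_add_one]
    linear_combination e1
  subst hA
  have hBC : B + C = (m + 2) ^ 2 := by
    refine Nat.eq_of_mul_eq_mul_left (Nat.mul_pos (Nat.succ_pos (m + 1)) (Nat.succ_pos m)) ?_
    simp only [Nat.succ_eq_add_one]
    linear_combination e2
  refine ⟨rfl, ?_, ?_⟩
  · linear_combination (m + 2) * hBC - e4
  · linear_combination e4 - m * hBC

end Count

/-! ### Transfer to PSL(2, 2^k) and the three parts -/

theorem map_centralizer_singleton {G G' : Type*} [Group G] [Group G'] (e : G ≃* G') (x : G) :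
    (Subgroup.centralizer {x}).map e.toMonoidHom = Subgroup.centralizer {e x} := by
  ext g
  rw [Subgroup.mem_centralizer_singleton_iff]
  constructor
  · rintro ⟨y, hy, rfl⟩
    have hy' := Subgroup.mem_centralizer_singleton_iff.mp hy
    simpa using congrArg e hy'
  · intro h
    refine ⟨e.symm g, Subgroup.mem_centralizer_singleton_iff.mpr (e.injective ?_), by simp⟩
    simpa using h

/-- Isomorphic groups have corresponding proper centralizers. -/
def properCentralizerCongr {G G' : Type*} [Group G] [Group G'] (e : G ≃* G') :
    ProperCentralizer G ≃ ProperCentralizer G' :=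
  Equiv.subtypeEquiv e.mapSubgroup.toEquiv fun H => by
    refine and_congr ⟨?_, ?_⟩ (not_congr ?_)
    · rintro ⟨x, rfl⟩
      exact ⟨e x, map_centralizer_singleton e x⟩
    · rintro ⟨x, hx⟩
      refine ⟨e.symm x, e.mapSubgroup.injective ?_⟩
      refine hx.trans ((map_centralizer_singleton e (e.symm x)).trans ?_).symm
      rw [e.apply_symm_apply]
    · exact (map_eq_top_iff e.mapSubgroup).symm

theorem card_properCentralizerCongr {G G' : Type*} [Group G] [Group G'] (e : G ≃* G')
    (H : ProperCentralizer G) : Nat.card (properCentralizerCongr e H).1 = Nat.card H.1 :=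
  (Nat.card_congr (e.subgroupMap H.1).toEquiv).symm

theorem card_properCentralizer_card_eq_congr {G G' : Type*} [Group G] [Group G'] (e : G ≃* G')
    (s : ℕ) : Nat.card {H : ProperCentralizer G // Nat.card H.1 = s} =
      Nat.card {H : ProperCentralizer G' // Nat.card H.1 = s} :=
  Nat.card_congr (Equiv.subtypeEquiv (properCentralizerCongr e) fun H => by
    rw [card_properCentralizerCongr])

/-- In characteristic two the center of `SL₂` is trivial, so that `PSL₂` is `SL₂`. -/
noncomputable def pslEquiv (k : ℕ) : PSL2 k ≃* Matrix.SpecialLinearGroup (Fin 2) (GaloisField 2 k) :=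
  (QuotientGroup.quotientMulEquivOfEq (center_SL_eq_bot (GaloisField 2 k))).trans
    QuotientGroup.quotientBot

/-- The part of the co-centralizer graph that a proper centralizer of `PSL(2, 2 ^ k)` lies in. -/
noncomputable def part (k : ℕ) (H : ProperCentralizer (PSL2 k)) : Fin 3 :=
  if Nat.card H.1 = 2 ^ k then 0 else if Nat.card H.1 = 2 ^ k - 1 then 1 else 2

theorem card_properCentralizer_PSL2_cases {k : ℕ} (hk : 2 ≤ k) (H : ProperCentralizer (PSL2 k)) :
    Nat.card H.1 = 2 ^ k ∨ Nat.card H.1 = 2 ^ k - 1 ∨ Nat.card H.1 = 2 ^ k + 1 := by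
  rw [← card_properCentralizerCongr (pslEquiv k), ← GaloisField.card 2 k (by omega)]
  exact card_properCentralizer_cases _

theorem part_eq_part_iff {k : ℕ} (hk : 2 ≤ k) (H K : ProperCentralizer (PSL2 k)) :
    part k H = part k K ↔ Nat.card H.1 = Nat.card K.1 := by
  have h1 := card_properCentralizer_PSL2_cases hk H
  have h2 := card_properCentralizer_PSL2_cases hk K
  have hq : 0 < 2 ^ k := by positivity
  simp only [part]
  split_ifs <;> simp <;> omega

/-- Taking k = n + 1 makes q/2 equal to 2^n, so the doubled counts for SL₂ can be halved. -/
theorem card_part {n : ℕ} (hn : 1 ≤ n) :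
    (Finset.univ.filter fun H => part (n + 1) H = 0).card = 2 ^ (n + 1) + 1 ∧
    (Finset.univ.filter fun H => part (n + 1) H = 1).card = 2 ^ n * (2 ^ (n + 1) + 1) ∧
    (Finset.univ.filter fun H => part (n + 1) H = 2).card = 2 ^ n * (2 ^ (n + 1) - 1) := by
  have hcard := GaloisField.card 2 (n + 1) (by omega)
  have hq : 2 < Nat.card (GaloisField 2 (n + 1)) := by
    rw [hcard]
    calc 2 < 2 ^ 2 := by norm_num
      _ ≤ 2 ^ (n + 1) := Nat.pow_le_pow_right (by norm_num) (by omega)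
  have h := card_properCentralizer_card_eq hq
  have hfil : ∀ (i : Fin 3) (s : ℕ),
      (∀ H : ProperCentralizer (PSL2 (n + 1)), part (n + 1) H = i ↔ Nat.card H.1 = s) →
      (Finset.univ.filter fun H => part (n + 1) H = i).card =
        Nat.card {H : ProperCentralizer
          (Matrix.SpecialLinearGroup (Fin 2) (GaloisField 2 (n + 1))) // Nat.card H.1 = s} := by
    intro i s his
    rw [← card_properCentralizer_card_eq_congr (pslEquiv (n + 1)), Nat.subtype_card]
    simpa using his
  have hpos : 0 < 2 ^ (n + 1) := by positivity
  rw [hcard] at h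
  refine ⟨?_, ?_, ?_⟩
  · rw [hfil 0 (2 ^ (n + 1)) ?_, h.1]
    intro H
    simp only [part]
    split_ifs <;> simp_all
  · rw [hfil 1 (2 ^ (n + 1) - 1) ?_]
    · refine Nat.eq_of_mul_eq_mul_left two_pos (h.2.1.trans ?_)
      ring
    · intro H
      simp only [part]
      split_ifs <;> simp <;> omega
  · rw [hfil 2 (2 ^ (n + 1) + 1) ?_]
    · refine Nat.eq_of_mul_eq_mul_left two_pos (h.2.2.trans ?_)
      rw [← mul_assoc, ← pow_succ']
    · intro H
      have := card_properCentralizer_PSL2_cases (k := n + 1) (by omega) H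
      simp only [part]
      split_ifs <;> simp <;> omega

end CoCentralizer

/-! ### The spectrum -/

open CoCentralizer in
theorem mainTheorem2 (k : ℕ) (hk : 2 ≤ k) :
    (CoCentralizer.coCentralizerGraph (CoCentralizer.PSL2 k)).Connected ∧
    Multiset.card (CoCentralizer.realSpectrum (CoCentralizer.quotientMatrix k)) = 3 ∧
    CoCentralizer.realSpectrum
        (CoCentralizer.distanceSignlessLaplacian
          (CoCentralizer.coCentralizerGraph (CoCentralizer.PSL2 k))) =
      Multiset.replicate (2 ^ k) ((2 : ℝ) ^ (k + 1) + 2 ^ (2 * k) - 2) +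
      Multiset.replicate (2 ^ (k - 1) * (2 ^ k + 1) - 1)
        (3 * (2 : ℝ) ^ (2 * k - 1) + 3 * 2 ^ (k - 1) - 3) +
      Multiset.replicate (2 ^ (k - 1) * (2 ^ k - 1) - 1)
        (3 * (2 : ℝ) ^ (2 * k - 1) + 2 ^ (k - 1) - 3) +
      CoCentralizer.realSpectrum (CoCentralizer.quotientMatrix k) := by
  obtain ⟨n, rfl⟩ : ∃ n, k = n + 1 := ⟨k - 1, by omega⟩
  obtain ⟨c0, c1, c2⟩ := card_part (n := n) (by omega)
  have hpow : 1 < 2 ^ (n + 1) := Nat.one_lt_two_pow (by omega)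
  have hsurj : Function.Surjective (part (n + 1)) := by
    intro i
    have : 0 < (Finset.univ.filter fun H => part (n + 1) H = i).card := by
      fin_cases i
      · simp only [Fin.zero_eta, c0]
        omega
      · simp only [Fin.mk_one, c1]
        positivity
      · simp only [Fin.reduceFinMk, c2]
        exact Nat.mul_pos (by positivity) (by omega)
    obtain ⟨H, hH⟩ := Finset.card_pos.mp this
    exact ⟨H, (Finset.mem_filter.mp hH).2⟩
  have hadj : ∀ H K, (coCentralizerGraph (PSL2 (n + 1))).Adj H K ↔
      part (n + 1) H ≠ part (n + 1) K := fun H K => by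
    rw [coCentralizerGraph_adj, Ne, Ne, part_eq_part_iff hk]
  have hV : Fintype.card (ProperCentralizer (PSL2 (n + 1))) =
      (2 ^ (n + 1) + 1) + 2 ^ n * (2 ^ (n + 1) + 1) + 2 ^ n * (2 ^ (n + 1) - 1) := by
    rw [← Finset.card_univ, Finset.card_eq_sum_card_fiberwise (f := part (n + 1))
      (t := Finset.univ) (by simp), Fin.sum_univ_three, c0, c1, c2]
  have hcast : ((2 ^ (n + 1) - 1 : ℕ) : ℝ) = 2 * 2 ^ n - 1 := by
    rw [Nat.cast_sub hpow.le]
    push_cast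
    ring
  -- All powers become polynomials in 2^n, so that the entries can be compared by `ring`.
  have e1 : (2 : ℝ) ^ (2 * (n + 1)) = 4 * (2 ^ n) ^ 2 := by ring
  have e2 : (2 : ℝ) ^ (2 * (n + 1) - 1) = 2 * (2 ^ n) ^ 2 := by
    rw [show 2 * (n + 1) - 1 = 2 * n + 1 by omega]; ring
  have e3 : (2 : ℝ) ^ (n + 1) = 2 * 2 ^ n := by ring
  have e4 : (2 : ℝ) ^ (n + 1 + 1) = 4 * 2 ^ n := by ring
  let m : Fin 3 → ℝ := fun i => ((Finset.univ.filter fun H => part (n + 1) H = i).card : ℝ)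
  let d : Fin 3 → ℝ := fun i => (Fintype.card (ProperCentralizer (PSL2 (n + 1))) : ℝ) + m i - 4
  let w : Matrix (Fin 3) (Fin 3) ℝ := Matrix.of fun i j => if i = j then 2 else 1
  have m0 : m 0 = 2 * 2 ^ n + 1 := by
    simp only [m, c0]; push_cast; ring
  have m1 : m 1 = 2 ^ n * (2 * 2 ^ n + 1) := by
    simp only [m, c1]; push_cast; ring
  have m2 : m 2 = 2 ^ n * (2 * 2 ^ n - 1) := by
    simp only [m, c2]; rw [Nat.cast_mul, hcast]; push_cast; ring
  have hVr : (Fintype.card (ProperCentralizer (PSL2 (n + 1))) : ℝ) =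
      4 * (2 ^ n) ^ 2 + 2 * 2 ^ n + 1 := by
    rw [hV, Nat.cast_add, Nat.cast_mul _ (2 ^ (n + 1) - 1), hcast]; push_cast; ring
  have d0 : d 0 = 2 ^ (n + 1 + 1) + 2 ^ (2 * (n + 1)) - 2 := by
    simp only [d, hVr, m0, e1, e4]; ring
  have d1 : d 1 = 3 * 2 ^ (2 * (n + 1) - 1) + 3 * 2 ^ n - 3 := by
    simp only [d, hVr, m1, e2]; ring
  have d2 : d 2 = 3 * 2 ^ (2 * (n + 1) - 1) + 2 ^ n - 3 := by
    simp only [d, hVr, m2, e2]; ring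
  -- Off the diagonal the quotient matrix has the part size m j; on it, d i + 2 m i, the weight 2
  -- being the distance within a part.
  have hB : quotientMatrix (n + 1) = Matrix.diagonal d + w * Matrix.diagonal m := by
    ext i j
    rw [Matrix.add_apply, Matrix.mul_diagonal, Matrix.diagonal_apply]
    fin_cases i <;> fin_cases j <;>
      simp [quotientMatrix, w, d0, d1, d2, m0, m1, m2, e3] <;> ring
  have hw : w.IsSymm := by
    ext i j
    simp [w, eq_comm]
  obtain ⟨hsplit, hroots⟩ := roots_charpoly_block (part (n + 1)) hsurj d w hw
  refine ⟨connected_of_adj_iff hsurj hadj, ?_, ?_⟩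
  · rw [hB, realSpectrum, ← hsplit.natDegree_eq_card_roots, Matrix.charpoly_natDegree_eq_dim,
      Fintype.card_fin]
  · rw [hB, realSpectrum, realSpectrum, distanceSignlessLaplacian_of_adj_iff hsurj hadj]
    refine hroots.trans ?_
    rw [Fin.sum_univ_three, c0, c1, c2, d0, d1, d2]
    -- The multiplicity (2^(n+1) + 1) - 1 and the exponent n + 1 - 1 reduce definitionally.
    rfl
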